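/- Let $n\ge 4$ be even. A (right) Leibniz algebra is a vector space $L$ with a bilinear product satisfying $[[x,y],z]=[[x,z],y]+[x,[y,z]]$; put $L^1=L$, $L^{k+1}=[L^k,L]$. An $n$-dimensional $L$ is filiform if $\dim L^i=n-i$ for $2\le i\le n$. A linear map $P:L\to L$ is a pre-derivation if $P([[x,y],z])=[[P(x),y],z]+[[x,P(y)],z]+[[x,y],P(z)]$ for all $x,y,z\in L$, and a filiform Leibniz algebra $L$ is strongly nilpotent if every pre-derivation of $L$ is nilpotent. For $\beta_4,\dots,\beta_n,\gamma\in\mathbb C$ let $F_2(\beta_4,\dots,\beta_n,\gamma)$ be the complex algebra with basis $e_1,\dots,e_n$ and products $$[e_1,e_1]=e_3,\qquad [e_i,e_1]=e_{i+1}\ (3\le i\le n-1),\qquad [e_1,e_2]=\sum_{t=4}^n\beta_t e_t,$$ $$[e_2,e_2]=\gamma e_n,\qquad [e_j,e_2]=\sum_{t=j+2}^n\beta_{t-j+2}\,e_t\ (3\le j\le n-2),$$ all other products of basis vectors being zero. Theorem. Let $L$ be an $n$-dimensional complex filiform Leibniz algebra that is isomorphic to some $F_2(\beta_4,\dots,\beta_n,\gamma)$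 and is not strongly nilpotent. Then $L$ is isomorphic to at least one of the following algebras: 1. $F_2(0,\dots,0,\beta_{2s},0,\dots,0,\beta_{n-1},\beta_n,\gamma)$ with $\beta_{2s}=1$, for some integer $s$ with $2\le s\le\frac{n-2}{2}$ and some $\beta_{n-1},\beta_n,\gamma\in\mathbb C$ (that is, $\beta_k=0$ for all $4\le k\le n-2$ with $k\ne 2s$); 2. $F_2(0,\beta_5,0,\beta_7,0,\dots,0,\beta_{n-1},\beta_n,\gamma)$ for some values of the displayed parameters (that is, $\beta_k=0$ for all even $k$ with $4\le k\le n-2$). -/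

import Mathlib

namespace LeibnizPaper

variable {K L M : Type*} [Field K] [AddCommGroup L] [Module K L] [AddCommGroup M] [Module K M]

/-- A bilinear product `[x, y] = μ x y` makes `L` a (right) Leibniz algebra. -/
def IsLeibniz (μ : L →ₗ[K] L →ₗ[K] L) : Prop :=
  ∀ x y z : L, μ (μ x y) z = μ (μ x z) y + μ x (μ y z)

/-- The lower central series, shifted by one: `lowerSeries μ k` is `L^(k+1)`, so that
`L^1 = L` and `L^(k+1) = [L^k, L]` (the span of all products). -/
def lowerSeries (μ : L →ₗ[K] L →ₗ[K] L) : ℕ → Submodule K L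
  | 0 => ⊤
  | k + 1 => Submodule.span K {z | ∃ x ∈ lowerSeries μ k, ∃ y : L, z = μ x y}

/-- `L` is filiform: `dim L^i = n - i` for `2 ≤ i ≤ n`, where `n = dim L`. -/
def IsFiliform (μ : L →ₗ[K] L →ₗ[K] L) : Prop :=
  ∀ i : ℕ, 2 ≤ i → i ≤ Module.finrank K L →
    Module.finrank K (lowerSeries μ (i - 1)) = Module.finrank K L - i

/-- Pre-derivations of `L`. -/
def IsPreDerivation (μ : L →ₗ[K] L →ₗ[K] L) (P : L →ₗ[K] L) : Prop :=
  ∀ x y z : L, P (μ (μ x y) z) = μ (μ (P x) y) z + μ (μ x (P y)) z + μ (μ x y) (P z)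

/-- `L` is strongly nilpotent: every pre-derivation is a nilpotent linear map. -/
def IsStronglyNilpotent (μ : L →ₗ[K] L →ₗ[K] L) : Prop :=
  ∀ P : L →ₗ[K] L, IsPreDerivation μ P → ∃ m : ℕ, ∀ x : L, (P ^ m) x = 0

/-- Two algebras are isomorphic: there is a product-preserving linear bijection. -/
def Isomorphic (μ : L →ₗ[K] L →ₗ[K] L) (ν : M →ₗ[K] M →ₗ[K] M) : Prop :=
  ∃ f : L ≃ₗ[K] M, ∀ x y : L, f (μ x y) = ν (f x) (f y)

/-- The standard basis vector `e_k` of `ℂ^n`, numbered from `1` (so `1 ≤ k ≤ n`). -/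
def e (n k : ℕ) : Fin n → ℂ := fun t => if (t : ℕ) + 1 = k then 1 else 0

/-- The products `[e_i, e_j]` in the algebra `F_2(β_4, …, β_n, γ)`. Only the values
`β 4, …, β n` of the sequence `β` are used. -/
def F2table (n : ℕ) (β : ℕ → ℂ) (γ : ℂ) (i j : ℕ) : Fin n → ℂ :=
  if i = 1 ∧ j = 1 then e n 3
  else if 3 ≤ i ∧ i ≤ n - 1 ∧ j = 1 then e n (i + 1)
  else if i = 1 ∧ j = 2 then ∑ t ∈ Finset.Icc 4 n, β t • e n t
  else if i = 2 ∧ j = 2 then γ • e n n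
  else if 3 ≤ i ∧ i ≤ n - 2 ∧ j = 2 then
    ∑ t ∈ Finset.Icc (i + 2) n, β (t - i + 2) • e n t
  else 0

/-- The algebra `F_2(β_4, …, β_n, γ)`: the bilinear product on `ℂ^n` with
`[e_i, e_j] = F2table n β γ i j`. -/
noncomputable def F2 (n : ℕ) (β : ℕ → ℂ) (γ : ℂ) :
    (Fin n → ℂ) →ₗ[ℂ] (Fin n → ℂ) →ₗ[ℂ] (Fin n → ℂ) :=
  LinearMap.mk₂ ℂ
    (fun x y => ∑ i : Fin n, ∑ j : Fin n, (x i * y j) • F2table n β γ (i + 1) (j + 1))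
    (fun x x' y => by simp only [Pi.add_apply, add_mul, add_smul, Finset.sum_add_distrib])
    (fun c x y => by
      simp only [Pi.smul_apply, smul_eq_mul, mul_assoc, mul_smul, Finset.smul_sum])
    (fun x y y' => by simp only [Pi.add_apply, mul_add, add_smul, Finset.sum_add_distrib])
    (fun c x y => by
      simp only [Pi.smul_apply, smul_eq_mul, mul_left_comm _ c, mul_smul c, Finset.smul_sum])

end LeibnizPaper

/-! Work with generators `u = e₁`, `v = e₂` and write X, Y for right multiplication by them. The
powers `u^k = X^k u` are, for `k ≥ 1`, the vectors `e_{k+2}`; they filter `L` by `tail`, X raises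
the filtration by one and Y by at least two. Right multiplication by `tail μ u 1` is zero, so X and
Y commute and XY is the polynomial `∑ β_{i+2} X^{i+1}` in X.

Let P be a pre-derivation, `P u ≡ p u + p' v`, and put `C = pX + p'Y`. Then `P X² = X² P + 2CX`, so
P on the powers of `u` is determined separately on even and odd exponents. Since `n` is even, the
first vanishing power `u^{n-1}` has odd exponent, and this forces `P (u^1) ≡ r u^1 + r' v`
(`exists_preDerivation_mul_self`); also `P v ≡ q' v`. Computing P on `[[[u,u],v],u]` in two ways
yields two identities: `sum_preDerivation_degree`, whose lowest term gives `i p = q'`, and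
`sum_preDerivation_even`, which sees only even `i` and gives `r = 2p`.

Suppose some even-indexed `β_k` with `k ≤ n - 2` is nonzero. If `p = 0`, then `q' = r = 0` and P is
nilpotent (`preDerivation_nilpotent`). So a non-nilpotent P has `p ≠ 0` and `q' = d p` with `d ≥ 2`;
replacing `u` by a suitable `u + t v` removes `p'`. The first identity is then diagonal and leaves
at most one nonzero coefficient up to `n - 2`; if its index is even, rescaling `v` makes it 1. -/

namespace LeibnizPaper

/-! ### Right powers, their filtration, and the relations between the two generators. -/

section Pair

variable {L : Type*} [AddCommGroup L] [Module ℂ L]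

/-- `rightPow μ u k = [[…[u, u], …], u]`, the element `u` multiplied `k` times on the right by
`u`. -/
def rightPow (μ : L →ₗ[ℂ] L →ₗ[ℂ] L) (u : L) (k : ℕ) : L := ((μ.flip u) ^ k) u

/-- The span of the right powers of `u` of exponent at least `k`. -/
def tail (μ : L →ₗ[ℂ] L →ₗ[ℂ] L) (u : L) (k : ℕ) : Submodule ℂ L :=
  Submodule.span ℂ (rightPow μ u '' Set.Ici k)

/-- The elements `u`, `v` generate `L` subject to the relations that `e₁`, `e₂` satisfy in
`F_2(β, γ)`. -/
structure IsF2Pair (μ : L →ₗ[ℂ] L →ₗ[ℂ] L) (n : ℕ) (u v : L) (β : ℕ → ℂ) (γ : ℂ) : Prop where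
  vu : μ v u = 0
  vv : μ v v = γ • rightPow μ u (n - 2)
  uv : μ u v = ∑ i ∈ Finset.Icc 2 (n - 2), β (i + 2) • rightPow μ u i
  vanish : rightPow μ u (n - 1) = 0
  ne_zero : rightPow μ u (n - 2) ≠ 0
  span_eq : Submodule.span ℂ ({v} ∪ Set.range (rightPow μ u)) = ⊤

variable {μ : L →ₗ[ℂ] L →ₗ[ℂ] L} {n : ℕ} {u v : L} {β : ℕ → ℂ} {γ : ℂ}

@[simp] lemma rightPow_zero : rightPow μ u 0 = u := rfl

lemma rightPow_succ (k : ℕ) : rightPow μ u (k + 1) = μ (rightPow μ u k) u := by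
  simp [rightPow, pow_succ']

lemma flip_rightPow (k : ℕ) : μ.flip u (rightPow μ u k) = rightPow μ u (k + 1) :=
  (rightPow_succ k).symm

lemma flip_pow_rightPow (j k : ℕ) :
    ((μ.flip u) ^ j) (rightPow μ u k) = rightPow μ u (k + j) := by
  rw [rightPow, rightPow, ← Module.End.mul_apply, ← pow_add, add_comm]

lemma rightPow_mem_tail {j k : ℕ} (h : k ≤ j) : rightPow μ u j ∈ tail μ u k :=
  Submodule.subset_span ⟨j, h, rfl⟩

lemma tail_anti {j k : ℕ} (h : k ≤ j) : tail μ u j ≤ tail μ u k :=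
  Submodule.span_mono (Set.image_mono (Set.Ici_subset_Ici.2 h))

lemma tail_le {k : ℕ} {S : Submodule ℂ L} (h : ∀ j, k ≤ j → rightPow μ u j ∈ S) :
    tail μ u k ≤ S := by
  rw [tail, Submodule.span_le]
  rintro _ ⟨j, hj, rfl⟩
  exact h j hj

lemma map_mem_of_mem_tail {k : ℕ} {S : Submodule ℂ L} (T : L →ₗ[ℂ] L)
    (h : ∀ j, k ≤ j → T (rightPow μ u j) ∈ S) {x : L} (hx : x ∈ tail μ u k) : T x ∈ S :=
  tail_le (S := S.comap T) h hx

lemma flip_mem_tail {k : ℕ} {x : L} (hx : x ∈ tail μ u k) : μ.flip u x ∈ tail μ u (k + 1) := by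
  refine map_mem_of_mem_tail _ (fun j hj => ?_) hx
  rw [flip_rightPow]
  exact rightPow_mem_tail (by omega)

lemma flip_pow_mem_tail {k : ℕ} (j : ℕ) {x : L} (hx : x ∈ tail μ u k) :
    ((μ.flip u) ^ j) x ∈ tail μ u (k + j) := by
  induction j with
  | zero => simpa using hx
  | succ j ih => rw [pow_succ', Module.End.mul_apply]; exact flip_mem_tail ih

lemma exists_sub_smul_mem_tail {k : ℕ} {x : L} (hx : x ∈ tail μ u k) :
    ∃ a : ℂ, x - a • rightPow μ u k ∈ tail μ u (k + 1) := by
  have : tail μ u k ≤ Submodule.span ℂ {rightPow μ u k} ⊔ tail μ u (k + 1) := by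
    refine tail_le fun j hj => ?_
    rcases hj.eq_or_lt with rfl | hj
    · exact Submodule.mem_sup_left (Submodule.mem_span_singleton_self _)
    · exact Submodule.mem_sup_right (rightPow_mem_tail hj)
  obtain ⟨y, hy, z, hz, rfl⟩ := Submodule.mem_sup.1 (this hx)
  obtain ⟨a, rfl⟩ := Submodule.mem_span_singleton.1 hy
  exact ⟨a, by simpa using hz⟩

lemma mul_sq_eq_zero (hL : IsLeibniz μ) (x y : L) : μ x (μ y y) = 0 := by
  simpa using hL x y y

lemma mul_rightPow (hL : IsLeibniz μ) (x : L) (k : ℕ) : μ x (rightPow μ u (k + 1)) = 0 := by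
  induction k generalizing x with
  | zero => rw [rightPow_succ]; exact mul_sq_eq_zero hL x u
  | succ k ih =>
    have h := hL x (rightPow μ u (k + 1)) u
    rw [ih, ih] at h
    rw [rightPow_succ]
    simpa using h.symm

lemma mul_of_mem_tail (hL : IsLeibniz μ) (x : L) {y : L} (hy : y ∈ tail μ u 1) : μ x y = 0 := by
  have := map_mem_of_mem_tail (S := ⊥) (μ x) (fun j hj => ?_) hy
  · simpa using this
  · obtain ⟨j, rfl⟩ := Nat.exists_eq_add_of_le' hj
    simpa using mul_rightPow hL x j

/-- As a right factor an element acts only through its two leading coefficients, because the tail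
acts as zero. -/
lemma mul_of_sub_mem_tail (hL : IsLeibniz μ) {y : L} {a c : ℂ}
    (hy : y - a • u - c • v ∈ tail μ u 1) (x : L) :
    μ x y = (a • μ.flip u + c • μ.flip v) x := by
  have := mul_of_mem_tail hL x hy
  simp only [map_sub, map_smul] at this
  simp only [LinearMap.add_apply, LinearMap.smul_apply, LinearMap.flip_apply]
  linear_combination (norm := module) this

namespace IsF2Pair

lemma rightPow_eq_zero (h : IsF2Pair μ n u v β γ) {k : ℕ} (hk : n - 1 ≤ k) :
    rightPow μ u k = 0 := by
  obtain ⟨j, rfl⟩ := Nat.exists_eq_add_of_le hk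
  rw [← flip_pow_rightPow, h.vanish, map_zero]

lemma eq_zero_of_mem_tail (h : IsF2Pair μ n u v β γ) {k : ℕ} (hk : n - 1 ≤ k) {x : L}
    (hx : x ∈ tail μ u k) : x = 0 := by
  have : tail μ u k ≤ ⊥ := tail_le fun j hj => by
    simpa using h.rightPow_eq_zero (hk.trans hj)
  simpa using this hx

/-- Applying X `n - 2 - k` times moves the leading term to the last nonzero power and kills the
rest. This replaces linear independence of the powers in all coefficient comparisons. -/
lemma coeff_eq_zero (h : IsF2Pair μ n u v β γ) {k : ℕ} (hk : k + 2 ≤ n) {a : ℂ}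
    (ha : a • rightPow μ u k ∈ tail μ u (k + 1)) : a = 0 := by
  have h1 := flip_pow_mem_tail (n - 2 - k) ha
  rw [map_smul, flip_pow_rightPow] at h1
  have h2 := h.eq_zero_of_mem_tail (by omega) h1
  rw [show k + (n - 2 - k) = n - 2 by omega] at h2
  exact (smul_eq_zero.1 h2).resolve_right h.ne_zero

lemma uv_mem (h : IsF2Pair μ n u v β γ) : μ u v ∈ tail μ u 2 := by
  rw [h.uv]
  exact Submodule.sum_mem _ fun i hi =>
    Submodule.smul_mem _ _ (rightPow_mem_tail (Finset.mem_Icc.1 hi).1)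

lemma commute (h : IsF2Pair μ n u v β γ) (hL : IsLeibniz μ) :
    Commute (μ.flip u) (μ.flip v) := by
  ext x
  have := hL x u v
  rw [mul_of_mem_tail hL x (tail_anti one_le_two h.uv_mem), add_zero] at this
  simpa using this.symm

lemma mul_v (h : IsF2Pair μ n u v β γ) (hL : IsLeibniz μ) (k : ℕ) :
    μ (rightPow μ u k) v = ∑ i ∈ Finset.Icc 2 (n - 2), β (i + 2) • rightPow μ u (k + i) := by
  have h1 := ((h.commute hL).pow_left k).eq
  have h2 := LinearMap.congr_fun h1 u
  simp only [Module.End.mul_apply, LinearMap.flip_apply, h.uv, map_sum, map_smul] at h2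
  rw [rightPow, ← h2]
  refine Finset.sum_congr rfl fun i _ => ?_
  rw [flip_pow_rightPow, add_comm i k]

lemma flip_v_mem_tail (h : IsF2Pair μ n u v β γ) (hL : IsLeibniz μ) {k : ℕ} {x : L}
    (hx : x ∈ tail μ u k) : μ.flip v x ∈ tail μ u (k + 2) := by
  refine map_mem_of_mem_tail _ (fun j hj => ?_) hx
  rw [LinearMap.flip_apply, h.mul_v hL]
  exact Submodule.sum_mem _ fun i hi => Submodule.smul_mem _ _
    (rightPow_mem_tail (by have := (Finset.mem_Icc.1 hi).1; omega))

lemma ext_end (h : IsF2Pair μ n u v β γ) {S T : L →ₗ[ℂ] L} (hv : S v = T v)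
    (hw : ∀ k, S (rightPow μ u k) = T (rightPow μ u k)) : S = T := by
  refine LinearMap.ext_on h.span_eq ?_
  rintro x (rfl | ⟨k, rfl⟩)
  exacts [hv, hw k]

lemma exists_decomp (h : IsF2Pair μ n u v β γ) (x : L) :
    ∃ a c : ℂ, x - a • u - c • v ∈ tail μ u 1 := by
  have hx : x ∈ Submodule.span ℂ ({v} ∪ Set.range (rightPow μ u)) := h.span_eq ▸ trivial
  induction hx using Submodule.span_induction with
  | mem x hx =>
    rcases hx with rfl | ⟨k, rfl⟩
    · exact ⟨0, 1, by simp⟩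
    · cases k with
      | zero => exact ⟨1, 0, by simp⟩
      | succ k => exact ⟨0, 0, by simpa using rightPow_mem_tail (by omega)⟩
  | zero => exact ⟨0, 0, by simp⟩
  | add x y _ _ hx hy =>
    obtain ⟨a, c, hx⟩ := hx
    obtain ⟨a', c', hy⟩ := hy
    refine ⟨a + a', c + c', ?_⟩
    convert Submodule.add_mem _ hx hy using 1
    module
  | smul r x _ hx =>
    obtain ⟨a, c, hx⟩ := hx
    refine ⟨r * a, r * c, ?_⟩
    convert Submodule.smul_mem _ r hx using 1
    module

lemma flip_flip_v_v (h : IsF2Pair μ n u v β γ) (hn : 2 ≤ n) : μ.flip u (μ v v) = 0 := by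
  rw [h.vv, map_smul, flip_rightPow, h.rightPow_eq_zero (by omega), smul_zero]

/-- The extra factor X is what makes this hold on `v` too: Y sends `v` to a multiple of the last
power, which X kills, as X kills `v` itself. -/
lemma flip_mul_flip (h : IsF2Pair μ n u v β γ) (hL : IsLeibniz μ) (hn : 2 ≤ n) :
    μ.flip u * μ.flip v = ∑ i ∈ Finset.Icc 2 (n - 2), β (i + 2) • (μ.flip u) ^ (i + 1) := by
  refine h.ext_end ?_ fun k => ?_
  · have hv : ∀ i, ((μ.flip u) ^ (i + 1)) v = 0 := fun i => by
      rw [pow_succ, Module.End.mul_apply, LinearMap.flip_apply, h.vu, map_zero]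
    simp only [Module.End.mul_apply, LinearMap.sum_apply, LinearMap.smul_apply, hv, smul_zero,
      Finset.sum_const_zero]
    exact h.flip_flip_v_v hn
  · simp only [Module.End.mul_apply, LinearMap.sum_apply, LinearMap.smul_apply,
      flip_pow_rightPow]
    rw [LinearMap.flip_apply (m := rightPow μ u k), h.mul_v hL, map_sum]
    exact Finset.sum_congr rfl fun i _ => by rw [map_smul, flip_rightPow, add_assoc]

/-- The lowest nonzero coefficient in a vanishing combination of elements with leading terms
`c i • u^(i+2)`. -/
lemma leading_coeff_eq_zero (h : IsF2Pair μ n u v β γ) {a c : ℕ → ℂ} {z : ℕ → L}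
    (hz : ∀ i, z i - c i • rightPow μ u (i + 2) ∈ tail μ u (i + 3))
    (hsum : ∑ i ∈ Finset.Icc 2 (n - 2), a i • z i = 0) {m : ℕ} (hm2 : 2 ≤ m) (hmn : m + 4 ≤ n)
    (hlt : ∀ i, 2 ≤ i → i < m → a i = 0) : a m * c m = 0 := by
  refine h.coeff_eq_zero (k := m + 2) (by omega) ?_
  have hmem : m ∈ Finset.Icc 2 (n - 2) := Finset.mem_Icc.2 ⟨hm2, by omega⟩
  rw [← Finset.add_sum_erase _ _ hmem] at hsum
  have hrest : ∑ i ∈ (Finset.Icc 2 (n - 2)).erase m, a i • z i ∈ tail μ u (m + 3) := by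
    refine Submodule.sum_mem _ fun i hi => ?_
    obtain ⟨hne, hi⟩ := Finset.mem_erase.1 hi
    have hi2 := (Finset.mem_Icc.1 hi).1
    rcases lt_or_gt_of_ne hne with hlt' | hgt
    · simp [hlt i hi2 hlt']
    · refine Submodule.smul_mem _ _ ?_
      have h1 := tail_anti (show m + 3 ≤ i + 3 by omega) (hz i)
      have h2 : c i • rightPow μ u (i + 2) ∈ tail μ u (m + 3) :=
        Submodule.smul_mem _ _ (rightPow_mem_tail (by omega))
      simpa using Submodule.add_mem _ h1 h2
  have h3 := Submodule.neg_mem _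
    (Submodule.add_mem _ hrest (Submodule.smul_mem _ (a m) (hz m)))
  convert h3 using 1
  linear_combination (norm := module) hsum

lemma smul_v (h : IsF2Pair μ n u v β γ) {a : ℂ} (ha : a ≠ 0) :
    IsF2Pair μ n u (a • v) (fun k => a * β k) (a ^ 2 * γ) where
  vu := by simp [h.vu]
  vv := by simp [h.vv, smul_smul, sq, mul_assoc]
  uv := by simp [h.uv, Finset.smul_sum, smul_smul]
  vanish := h.vanish
  ne_zero := h.ne_zero
  span_eq := by
    rw [← h.span_eq, Submodule.span_union, Submodule.span_union,
      Submodule.span_singleton_smul_eq (IsUnit.mk0 a ha)]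

end IsF2Pair

end Pair

end LeibnizPaper

namespace LeibnizPaper

/-! ### Constraints on the leading coefficients of a pre-derivation. -/

section PreDerivation

variable {L : Type*} [AddCommGroup L] [Module ℂ L]
variable {μ : L →ₗ[ℂ] L →ₗ[ℂ] L} {n : ℕ} {u v : L} {β : ℕ → ℂ} {γ : ℂ}
variable {P : L →ₗ[ℂ] L} {p p' q' : ℂ}

namespace IsF2Pair

lemma commute_comb (h : IsF2Pair μ n u v β γ) (hL : IsLeibniz μ) (a c : ℂ) :
    Commute (μ.flip u) (a • μ.flip u + c • μ.flip v) :=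
  ((Commute.refl _).smul_right a).add_right ((h.commute hL).smul_right c)

lemma comb_mem_tail (h : IsF2Pair μ n u v β γ) (hL : IsLeibniz μ) (a c : ℂ) {k : ℕ} {x : L}
    (hx : x ∈ tail μ u k) :
    (a • μ.flip u + c • μ.flip v) x - a • μ.flip u x ∈ tail μ u (k + 2) := by
  have := Submodule.smul_mem _ c (h.flip_v_mem_tail hL hx)
  simpa using this

lemma preDerivation_sq (h : IsF2Pair μ n u v β γ) (hL : IsLeibniz μ) (hP : IsPreDerivation μ P)
    (hPu : P u - p • u - p' • v ∈ tail μ u 1) (x : L) :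
    P (μ.flip u (μ.flip u x)) = μ.flip u (μ.flip u (P x)) +
      (2 : ℂ) • (p • μ.flip u + p' • μ.flip v) (μ.flip u x) := by
  have h1 := hP x u u
  rw [mul_of_sub_mem_tail hL hPu, mul_of_sub_mem_tail hL hPu] at h1
  have h2 := LinearMap.congr_fun (h.commute_comb hL p p').eq x
  rw [Module.End.mul_apply, Module.End.mul_apply] at h2
  rw [two_smul, ← add_assoc]
  nth_rw 1 [← h2]
  exact h1

lemma preDerivation_mul (hL : IsLeibniz μ) (hP : IsPreDerivation μ P)
    (hPu : P u - p • u - p' • v ∈ tail μ u 1) (hPv : P v - q' • v ∈ tail μ u 1) (x : L) :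
    P (μ.flip u (μ.flip v x)) = μ.flip u (μ.flip v (P x)) + q' • μ.flip u (μ.flip v x) +
      (p • μ.flip u + p' • μ.flip v) (μ.flip v x) := by
  have h1 := hP x v u
  have hPv' : P v - (0 : ℂ) • u - q' • v ∈ tail μ u 1 := by simpa using hPv
  rw [mul_of_sub_mem_tail hL hPu, mul_of_sub_mem_tail hL hPv'] at h1
  simpa using h1

/-- Since X kills `v`, the relation `P X² = X² P + 2CX` gives `X² (P v) = 0`, which rules out a
`u`-component. -/
lemma exists_preDerivation_v (h : IsF2Pair μ n u v β γ) (hL : IsLeibniz μ) (hn : 4 ≤ n)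
    (hP : IsPreDerivation μ P) : ∃ q' : ℂ, P v - q' • v ∈ tail μ u 1 := by
  obtain ⟨p, p', hPu⟩ := h.exists_decomp (P u)
  obtain ⟨q, q', hPv⟩ := h.exists_decomp (P v)
  have h0 : μ.flip u v = 0 := h.vu
  have h1 := h.preDerivation_sq hL hP hPu v
  rw [h0] at h1
  simp only [map_zero, smul_zero, add_zero] at h1
  have h2 := flip_mem_tail (flip_mem_tail hPv)
  simp only [map_sub, map_smul, h0, ← h1] at h2
  have h3 : q • rightPow μ u 2 ∈ tail μ u (2 + 1) := by
    have h4 := Submodule.neg_mem _ h2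
    simp only [smul_zero, map_zero, zero_sub, sub_zero, neg_neg] at h4
    exact h4
  have hq := h.coeff_eq_zero (by omega) h3
  subst hq
  exact ⟨q', by simpa using hPv⟩

lemma preDerivation_rightPow_add_two (h : IsF2Pair μ n u v β γ) (hL : IsLeibniz μ)
    (hP : IsPreDerivation μ P) (hPu : P u - p • u - p' • v ∈ tail μ u 1) (i : ℕ) :
    P (rightPow μ u (i + 2)) = μ.flip u (μ.flip u (P (rightPow μ u i))) +
      (2 : ℂ) • (p • μ.flip u + p' • μ.flip v) (rightPow μ u (i + 1)) := by
  have := h.preDerivation_sq hL hP hPu (rightPow μ u i)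
  rwa [flip_rightPow, flip_rightPow] at this

lemma flip_comb_rightPow (h : IsF2Pair μ n u v β γ) (hL : IsLeibniz μ) (a c : ℂ) (i : ℕ) :
    μ.flip u ((a • μ.flip u + c • μ.flip v) (rightPow μ u i)) =
      (a • μ.flip u + c • μ.flip v) (rightPow μ u (i + 1)) := by
  have := LinearMap.congr_fun (h.commute_comb hL a c).eq (rightPow μ u i)
  rwa [Module.End.mul_apply, Module.End.mul_apply, flip_rightPow] at this

lemma exists_preDerivation_mul_self (h : IsF2Pair μ n u v β γ) (hL : IsLeibniz μ) (hn : 4 ≤ n)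
    (hev : Even n) (hP : IsPreDerivation μ P) :
    ∃ r r' : ℂ, P (rightPow μ u 1) - r • rightPow μ u 1 - r' • v ∈ tail μ u 2 := by
  obtain ⟨p, p', hPu⟩ := h.exists_decomp (P u)
  obtain ⟨r, r', hr⟩ := h.exists_decomp (P (rightPow μ u 1))
  -- Going up in steps of two relates every odd power to `P (u^1)`. Evenness of `n` makes `n - 1`
  -- odd, so the vanishing of `u^{n-1}` yields `X^{n-2} (P (u^1)) = 0`, hence no `u`-component.
  have hodd : ∀ k, P (rightPow μ u (2 * k + 1)) -
      ((μ.flip u) ^ (2 * k)) (P (rightPow μ u 1)) ∈ tail μ u (2 * k + 1) := by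
    intro k
    induction k with
    | zero => simp
    | succ k ih =>
      have h1 := flip_mem_tail (flip_mem_tail ih)
      rw [show 2 * (k + 1) + 1 = 2 * k + 1 + 2 by ring,
        h.preDerivation_rightPow_add_two hL hP hPu,
        show 2 * (k + 1) = 2 * k + 1 + 1 by ring, pow_succ', pow_succ', Module.End.mul_apply,
        Module.End.mul_apply]
      have h2 := h.comb_mem_tail hL p p' (rightPow_mem_tail (μ := μ) (u := u)
        (le_refl (2 * k + 1 + 1)))
      rw [flip_rightPow] at h2
      have h3 := Submodule.add_mem _ (tail_anti (by omega) h2)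
        (Submodule.smul_mem _ p (rightPow_mem_tail (μ := μ) (u := u)
          (show 2 * k + 1 + 2 ≤ 2 * k + 1 + 1 + 1 by omega)))
      have h4 := Submodule.add_mem _ h1 (Submodule.smul_mem _ (2 : ℂ) h3)
      convert h4 using 1
      simp only [map_sub]
      module
  obtain ⟨m, hm⟩ := hev
  have h1 := hodd (m - 1)
  rw [show 2 * (m - 1) + 1 = n - 1 by omega, show 2 * (m - 1) = n - 2 by omega, h.vanish, map_zero,
    zero_sub] at h1
  have h2 := h.eq_zero_of_mem_tail le_rfl h1
  rw [neg_eq_zero] at h2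
  have h3 := h.eq_zero_of_mem_tail (by omega) (flip_pow_mem_tail (n - 2) hr)
  have hv : ((μ.flip u) ^ (n - 2)) v = 0 := by
    rw [show n - 2 = n - 3 + 1 by omega, pow_succ, Module.End.mul_apply, LinearMap.flip_apply,
      h.vu, map_zero]
  simp only [map_sub, map_smul, h2, hv, smul_zero, zero_sub, sub_zero, neg_eq_zero] at h3
  have hr0 := (smul_eq_zero.1 h3).resolve_right h.ne_zero
  subst hr0
  obtain ⟨a, ha⟩ := exists_sub_smul_mem_tail hr
  refine ⟨a, r', ?_⟩
  convert ha using 1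
  module

/-- The recursion for P has step two; adding neighbouring exponents removes the dependence on
parity. The companion difference below isolates it as a sign. -/
lemma preDerivation_add_aux (h : IsF2Pair μ n u v β γ) (hL : IsLeibniz μ)
    (hP : IsPreDerivation μ P) (hPu : P u - p • u - p' • v ∈ tail μ u 1) (i : ℕ) :
    μ.flip u (μ.flip u (P (rightPow μ u i))) + μ.flip u (P (rightPow μ u (i + 1))) =
      ((μ.flip u) ^ (i + 2)) (P u) + ((μ.flip u) ^ (i + 1)) (P (rightPow μ u 1)) +
      (2 * i : ℂ) • (p • μ.flip u + p' • μ.flip v) (rightPow μ u (i + 1)) := by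
  induction i with
  | zero => simp [pow_two]
  | succ i ih =>
    have h1 := congrArg (μ.flip u) ih
    simp only [map_add, map_smul _ (2 * i : ℂ), h.flip_comb_rightPow hL] at h1
    rw [h.preDerivation_rightPow_add_two hL hP hPu, map_add, map_smul, h.flip_comb_rightPow hL,
      show i + 1 + 2 = i + 1 + 1 + 1 from rfl, Nat.cast_succ]
    simp only [pow_succ', Module.End.mul_apply] at h1 ⊢
    linear_combination (norm := module) h1

lemma preDerivation_sub_aux (h : IsF2Pair μ n u v β γ) (hL : IsLeibniz μ)
    (hP : IsPreDerivation μ P) (hPu : P u - p • u - p' • v ∈ tail μ u 1) (i : ℕ) :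
    μ.flip u (μ.flip u (P (rightPow μ u i))) - μ.flip u (P (rightPow μ u (i + 1))) =
      (-1 : ℂ) ^ i • (((μ.flip u) ^ (i + 2)) (P u) -
        ((μ.flip u) ^ (i + 1)) (P (rightPow μ u 1))) -
      (1 - (-1 : ℂ) ^ i) • (p • μ.flip u + p' • μ.flip v) (rightPow μ u (i + 1)) := by
  induction i with
  | zero => simp [pow_two]
  | succ i ih =>
    have h1 := congrArg (μ.flip u) ih
    simp only [map_sub, map_smul _ ((-1 : ℂ) ^ i), map_smul _ (1 - (-1 : ℂ) ^ i),
      h.flip_comb_rightPow hL] at h1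
    rw [h.preDerivation_rightPow_add_two hL hP hPu, map_add, map_smul, h.flip_comb_rightPow hL,
      show i + 1 + 2 = i + 1 + 1 + 1 from rfl, pow_succ (-1 : ℂ)]
    simp only [pow_succ' (μ.flip u), Module.End.mul_apply] at h1 ⊢
    linear_combination (norm := module) -h1

lemma flip_flip_v_eq_sum (h : IsF2Pair μ n u v β γ) (hL : IsLeibniz μ) (hn : 2 ≤ n) (x : L) :
    μ.flip u (μ.flip v x) =
      ∑ i ∈ Finset.Icc 2 (n - 2), β (i + 2) • ((μ.flip u) ^ (i + 1)) x := by
  rw [← Module.End.mul_apply, h.flip_mul_flip hL hn]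
  simp

/-- The value of a pre-derivation on `[[[u, u], v], u]`, computed by way of `[u, v]`. -/
lemma preDerivation_eval_left (h : IsF2Pair μ n u v β γ) (hL : IsLeibniz μ)
    (hP : IsPreDerivation μ P) (hPu : P u - p • u - p' • v ∈ tail μ u 1)
    (hPv : P v - q' • v ∈ tail μ u 1) :
    μ.flip u (μ.flip u (P (μ u v))) + μ.flip u ((p • μ.flip u + p' • μ.flip v) (μ u v)) =
      μ.flip u (μ.flip v (P (rightPow μ u 1))) + q' • μ.flip u (μ.flip u (μ u v)) := by
  have h1 := preDerivation_mul hL hP hPu hPv (rightPow μ u 1)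
  have h2 : μ.flip v (rightPow μ u 1) = μ.flip u (μ u v) := by
    have := LinearMap.congr_fun (h.commute hL).eq u
    exact this.symm
  have h3 := LinearMap.congr_fun (h.commute_comb hL p p').eq (μ u v)
  rw [Module.End.mul_apply, Module.End.mul_apply] at h3
  rw [h2, h.preDerivation_sq hL hP hPu, ← h3] at h1
  linear_combination (norm := module) h1

lemma preDerivation_eval_right (hL : IsLeibniz μ)
    (hP : IsPreDerivation μ P) (hPu : P u - p • u - p' • v ∈ tail μ u 1)
    (hPv : P v - q' • v ∈ tail μ u 1) :
    μ.flip u (P (μ.flip u (μ u v))) =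
      μ.flip u (μ.flip u (μ.flip v (P u))) + q' • μ.flip u (μ.flip u (μ u v)) +
      μ.flip u ((p • μ.flip u + p' • μ.flip v) (μ u v)) := by
  have := congrArg (μ.flip u) (preDerivation_mul hL hP hPu hPv u)
  rw [map_add, map_add, map_smul] at this
  exact this

/-- Adding the two evaluations, the terms in `P u` and `P (u^1)` cancel because XY is a polynomial
in X; only C and `q'` survive. -/
lemma sum_preDerivation_degree (h : IsF2Pair μ n u v β γ) (hL : IsLeibniz μ) (hn : 2 ≤ n)
    (hP : IsPreDerivation μ P) (hPu : P u - p • u - p' • v ∈ tail μ u 1)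
    (hPv : P v - q' • v ∈ tail μ u 1) :
    ∑ i ∈ Finset.Icc 2 (n - 2), β (i + 2) •
      ((i : ℂ) • (p • μ.flip u + p' • μ.flip v) (rightPow μ u (i + 1)) -
        q' • rightPow μ u (i + 2)) = 0 := by
  have h1 := h.preDerivation_eval_left hL hP hPu hPv
  have h2 := preDerivation_eval_right hL hP hPu hPv
  have h3 : ∑ i ∈ Finset.Icc 2 (n - 2), β (i + 2) •
      (μ.flip u (μ.flip u (P (rightPow μ u i))) + μ.flip u (P (rightPow μ u (i + 1)))) =
      μ.flip u (μ.flip u (P (μ u v))) + μ.flip u (P (μ.flip u (μ u v))) := by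
    simp only [smul_add, Finset.sum_add_distrib, h.uv, map_sum, map_smul, flip_rightPow]
  have h4 : μ.flip u (μ.flip u (μ u v)) =
      ∑ i ∈ Finset.Icc 2 (n - 2), β (i + 2) • rightPow μ u (i + 2) := by
    simp only [h.uv, map_sum, map_smul, flip_rightPow]
  have h5 := h.flip_flip_v_eq_sum hL hn (P (rightPow μ u 1))
  have h6 : μ.flip u (μ.flip u (μ.flip v (P u))) =
      ∑ i ∈ Finset.Icc 2 (n - 2), β (i + 2) • ((μ.flip u) ^ (i + 2)) (P u) := by
    simp only [h.flip_flip_v_eq_sum hL hn (P u), map_sum, map_smul, pow_succ' _ (_ + 1),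
      Module.End.mul_apply]
  simp only [h.preDerivation_add_aux hL hP hPu, smul_add, Finset.sum_add_distrib] at h3
  rw [← h5, ← h6] at h3
  have h7 : (2 : ℂ) • ∑ i ∈ Finset.Icc 2 (n - 2), β (i + 2) •
      ((i : ℂ) • (p • μ.flip u + p' • μ.flip v) (rightPow μ u (i + 1))) =
      (2 : ℂ) • q' • μ.flip u (μ.flip u (μ u v)) := by
    simp only [Finset.smul_sum, smul_smul] at h3 ⊢
    have h8 : ∀ i : ℕ, (2 * (β (i + 2) * i) : ℂ) = β (i + 2) * (2 * i) := fun i => by ring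
    simp only [h8]
    linear_combination (norm := module) h3 + h1 + h2
  have h9 := smul_right_injective L (two_ne_zero (α := ℂ)) h7
  simp only [smul_sub, Finset.sum_sub_distrib]
  rw [h9, h4, sub_eq_zero, Finset.smul_sum]
  exact Finset.sum_congr rfl fun i _ => smul_comm _ _ _

/-- Subtracting the two evaluations instead removes `q'` and leaves the factor `1 + (-1)^i`, so only
even `i` contribute. -/
lemma sum_preDerivation_even (h : IsF2Pair μ n u v β γ) (hL : IsLeibniz μ) (hn : 2 ≤ n)
    (hP : IsPreDerivation μ P) (hPu : P u - p • u - p' • v ∈ tail μ u 1)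
    (hPv : P v - q' • v ∈ tail μ u 1) :
    ∑ i ∈ Finset.Icc 2 (n - 2), (β (i + 2) * (1 + (-1) ^ i)) •
      (((μ.flip u) ^ (i + 2)) (P u) - ((μ.flip u) ^ (i + 1)) (P (rightPow μ u 1)) +
        (p • μ.flip u + p' • μ.flip v) (rightPow μ u (i + 1))) = 0 := by
  have h1 := h.preDerivation_eval_left hL hP hPu hPv
  have h2 := preDerivation_eval_right hL hP hPu hPv
  have h3 : ∑ i ∈ Finset.Icc 2 (n - 2), β (i + 2) •
      (μ.flip u (μ.flip u (P (rightPow μ u i))) - μ.flip u (P (rightPow μ u (i + 1)))) =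
      μ.flip u (μ.flip u (P (μ u v))) - μ.flip u (P (μ.flip u (μ u v))) := by
    simp only [smul_sub, Finset.sum_sub_distrib, h.uv, map_sum, map_smul, flip_rightPow]
  have h5 := h.flip_flip_v_eq_sum hL hn (P (rightPow μ u 1))
  have h6 : μ.flip u (μ.flip u (μ.flip v (P u))) =
      ∑ i ∈ Finset.Icc 2 (n - 2), β (i + 2) • ((μ.flip u) ^ (i + 2)) (P u) := by
    simp only [h.flip_flip_v_eq_sum hL hn (P u), map_sum, map_smul, pow_succ' _ (_ + 1),
      Module.End.mul_apply]
  have h7 : μ.flip u ((p • μ.flip u + p' • μ.flip v) (μ u v)) =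
      ∑ i ∈ Finset.Icc 2 (n - 2), β (i + 2) •
        (p • μ.flip u + p' • μ.flip v) (rightPow μ u (i + 1)) := by
    rw [h.uv, map_sum, map_sum]
    exact Finset.sum_congr rfl fun i _ => by rw [map_smul, map_smul, h.flip_comb_rightPow hL]
  have h8 : ∀ i : ℕ, (β (i + 2) * (1 + (-1) ^ i)) •
      (((μ.flip u) ^ (i + 2)) (P u) - ((μ.flip u) ^ (i + 1)) (P (rightPow μ u 1)) +
        (p • μ.flip u + p' • μ.flip v) (rightPow μ u (i + 1))) =
      β (i + 2) • (μ.flip u (μ.flip u (P (rightPow μ u i))) -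
        μ.flip u (P (rightPow μ u (i + 1)))) +
      β (i + 2) • ((μ.flip u) ^ (i + 2)) (P u) -
      β (i + 2) • ((μ.flip u) ^ (i + 1)) (P (rightPow μ u 1)) +
      (2 : ℂ) • β (i + 2) • (p • μ.flip u + p' • μ.flip v) (rightPow μ u (i + 1)) := fun i => by
    rw [h.preDerivation_sub_aux hL hP hPu]
    module
  simp only [h8, Finset.sum_add_distrib, Finset.sum_sub_distrib]
  rw [h3, ← h5, ← h6, ← Finset.smul_sum, ← h7]
  linear_combination (norm := module) h1 - h2

end IsF2Pair

end PreDerivation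

end LeibnizPaper

namespace LeibnizPaper

/-! ### Nilpotency criterion, change of generators, and the normal form. -/

section NormalForm

variable {L : Type*} [AddCommGroup L] [Module ℂ L]
variable {μ : L →ₗ[ℂ] L →ₗ[ℂ] L} {n : ℕ} {u v : L} {β : ℕ → ℂ} {γ : ℂ}
variable {P : L →ₗ[ℂ] L} {p p' q' r r' : ℂ}

lemma exists_eq_sum_of_mem_tail {k : ℕ} (hn : 2 ≤ n) (h0 : rightPow μ u (n - 1) = 0) {x : L}
    (hx : x ∈ tail μ u k) :
    ∃ c : ℕ → ℂ, x = ∑ i ∈ Finset.Icc k (n - 2), c i • rightPow μ u i := by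
  have hle : tail μ u k ≤
      Submodule.span ℂ (rightPow μ u '' (Finset.Icc k (n - 2) : Finset ℕ)) := by
    refine tail_le fun j hj => ?_
    by_cases hjn : j ≤ n - 2
    · exact Submodule.subset_span ⟨j, by simp [hj, hjn], rfl⟩
    · obtain ⟨i, rfl⟩ := Nat.exists_eq_add_of_le (show n - 1 ≤ j by omega)
      rw [← flip_pow_rightPow, h0, map_zero]
      exact Submodule.zero_mem _
  obtain ⟨c, hc⟩ := (Submodule.mem_span_image_finset_iff_exists_fun' ℂ).1 (hle hx)
  exact ⟨c, hc.symm⟩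

namespace IsF2Pair

lemma flip_pow_succ_v (h : IsF2Pair μ n u v β γ) (k : ℕ) : ((μ.flip u) ^ (k + 1)) v = 0 := by
  rw [pow_succ, Module.End.mul_apply, LinearMap.flip_apply, h.vu, map_zero]

lemma preDerivation_v_mem_tail (h : IsF2Pair μ n u v β γ) (hL : IsLeibniz μ) (hn : 5 ≤ n)
    (hP : IsPreDerivation μ P) (hPv : P v - q' • v ∈ tail μ u 1) :
    P v - q' • v ∈ tail μ u 2 := by
  obtain ⟨p, p', hPu⟩ := h.exists_decomp (P u)
  obtain ⟨a, ha⟩ := exists_sub_smul_mem_tail hPv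
  have h0 : μ.flip u v = 0 := h.vu
  have h1 := h.preDerivation_sq hL hP hPu v
  rw [h0] at h1
  simp only [map_zero, smul_zero, add_zero] at h1
  have h2 := Submodule.neg_mem _ (flip_mem_tail (flip_mem_tail ha))
  simp only [map_sub, map_smul, h0, ← h1, smul_zero, zero_sub, sub_zero, neg_neg,
    flip_rightPow] at h2
  have := h.coeff_eq_zero (by omega) h2
  subst this
  simpa using ha

/-- With no diagonal part, P strictly raises the filtration from exponent 2 on. Components along `v`
may appear before that, but three applications of P bring everything into `tail μ u 2`. -/
lemma preDerivation_nilpotent (h : IsF2Pair μ n u v β γ) (hL : IsLeibniz μ) (hn : 5 ≤ n)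
    (hP : IsPreDerivation μ P) (hPu : P u - p' • v ∈ tail μ u 1) (hPv : P v ∈ tail μ u 1)
    (hr : P (rightPow μ u 1) - r' • v ∈ tail μ u 2) : ∃ m : ℕ, ∀ x : L, (P ^ m) x = 0 := by
  have hPu' : P u - (0 : ℂ) • u - p' • v ∈ tail μ u 1 := by simpa using hPu
  have hPv2 : P v ∈ tail μ u 2 := by
    simpa using h.preDerivation_v_mem_tail hL hn hP (q' := 0) (by simpa using hPv)
  have hstep : ∀ k, (∃ c : ℂ, P (rightPow μ u k) - c • v ∈ tail μ u (k + 1)) →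
      P (rightPow μ u (k + 2)) ∈ tail μ u (k + 3) := by
    rintro k ⟨c, hk⟩
    have h1 := flip_mem_tail (flip_mem_tail hk)
    have h0 : μ.flip u v = 0 := h.vu
    simp only [map_sub, map_smul, h0, smul_zero, sub_zero] at h1
    rw [h.preDerivation_rightPow_add_two hL hP hPu']
    refine Submodule.add_mem _ h1 (Submodule.smul_mem _ _ ?_)
    have h2 := h.comb_mem_tail hL 0 p' (rightPow_mem_tail (μ := μ) (u := u) (le_refl (k + 1)))
    simpa using h2
  have hpow : ∀ k, (∃ c : ℂ, P (rightPow μ u k) - c • v ∈ tail μ u (k + 1)) ∧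
      (∃ c : ℂ, P (rightPow μ u (k + 1)) - c • v ∈ tail μ u (k + 2)) := by
    intro k
    induction k with
    | zero => exact ⟨⟨p', hPu⟩, ⟨r', hr⟩⟩
    | succ k ih => exact ⟨ih.2, 0, by simpa using hstep k ih.1⟩
  have htail : ∀ k x, x ∈ tail μ u (k + 2) → P x ∈ tail μ u (k + 3) := by
    intro k x hx
    refine map_mem_of_mem_tail P (fun j hj => ?_) hx
    obtain ⟨i, rfl⟩ := Nat.exists_eq_add_of_le hj
    exact tail_anti (by omega) (show P (rightPow μ u (k + 2 + i)) ∈ tail μ u (k + i + 3) by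
      rw [show k + 2 + i = k + i + 2 by ring]; exact hstep _ (hpow _).1)
  have htail2 : ∀ x ∈ tail μ u 1, (P ^ 2) x ∈ tail μ u 2 := by
    intro x hx
    obtain ⟨a, ha⟩ := exists_sub_smul_mem_tail hx
    have h1 := tail_anti (show 2 ≤ 3 by omega) (htail 0 _ ha)
    have h2 := Submodule.smul_mem _ a hr
    have h3 : P x - (a * r') • v ∈ tail μ u 2 := by
      convert Submodule.add_mem _ h1 h2 using 1
      simp only [map_sub, map_smul]
      module
    have h4 := tail_anti (show 2 ≤ 3 by omega) (htail 0 _ h3)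
    have h5 := Submodule.add_mem _ h4 (Submodule.smul_mem _ (a * r') hPv2)
    simpa [pow_two] using h5
  have hthree : ∀ x, (P ^ 3) x ∈ tail μ u 2 := by
    intro x
    obtain ⟨a, c, hx⟩ := h.exists_decomp x
    have h1 := htail2 _ hx
    have h2 := htail 0 _ h1
    have h3 : (P ^ 3) u ∈ tail μ u 2 := by
      have h4 := htail2 _ hPu
      have h5 := htail 1 _ (htail 0 _ hPv2)
      have h6 := Submodule.add_mem _ h4
        (Submodule.smul_mem _ p' (tail_anti (show 2 ≤ 3 by omega) (htail 0 _ hPv2)))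
      convert h6 using 1
      simp only [pow_succ, pow_zero, Module.End.mul_apply, Module.End.one_apply, map_sub,
        map_smul]
      module
    have h4 : (P ^ 3) v ∈ tail μ u 2 := by
      have := tail_anti (show 2 ≤ 4 by omega) (htail 1 _ (htail 0 _ hPv2))
      simpa only [pow_succ, pow_zero, Module.End.mul_apply, Module.End.one_apply] using this
    have h5 := Submodule.add_mem _ (Submodule.add_mem _ (tail_anti (show 2 ≤ 3 by omega) h2)
      (Submodule.smul_mem _ a h3)) (Submodule.smul_mem _ c h4)
    convert h5 using 1
    simp only [pow_succ, pow_zero, Module.End.mul_apply, Module.End.one_apply, map_sub,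
      map_smul]
    module
  have hiter : ∀ m x, (P ^ (m + 3)) x ∈ tail μ u (m + 2) := by
    intro m
    induction m with
    | zero => simpa using hthree
    | succ m ih =>
      intro x
      rw [show m + 1 + 3 = (m + 3) + 1 by ring, pow_succ', Module.End.mul_apply]
      exact htail m _ (ih x)
  exact ⟨n + 3, fun x => h.eq_zero_of_mem_tail (by omega) (hiter n x)⟩

/-- Y raises the filtration one step more than X, so adding `t • v` leaves the leading term
unchanged from exponent 1 on. -/
lemma add_smul_v_rightPow (h : IsF2Pair μ n u v β γ) (hL : IsLeibniz μ) (hn : 4 ≤ n) (t : ℂ)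
    (k : ℕ) :
    rightPow μ (u + t • v) (k + 1) - rightPow μ u (k + 1) ∈ tail μ u (k + 2) := by
  induction k with
  | zero =>
    have h1 : μ v v ∈ tail μ u 2 := by
      rw [h.vv]
      exact Submodule.smul_mem _ _ (rightPow_mem_tail (by omega))
    have h2 := Submodule.add_mem _ (Submodule.smul_mem _ t h.uv_mem)
      (Submodule.smul_mem _ (t ^ 2) h1)
    convert h2 using 1
    simp only [rightPow_succ, rightPow_zero, map_add, map_smul, LinearMap.add_apply,
      LinearMap.smul_apply, h.vu]
    module
  | succ k ih =>
    have h1 := flip_mem_tail ih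
    have h2 := h.flip_v_mem_tail hL ih
    have h3 := h.flip_v_mem_tail hL (rightPow_mem_tail (μ := μ) (u := u) (le_refl (k + 1)))
    have h4 := Submodule.add_mem _ h1 (Submodule.add_mem _
      (Submodule.smul_mem _ t (tail_anti (show k + 2 + 1 ≤ k + 2 + 2 by omega) h2))
      (Submodule.smul_mem _ t h3))
    convert h4 using 1
    rw [rightPow_succ (k + 1), rightPow_succ (k + 1)]
    simp only [map_add, map_sub, map_smul, LinearMap.flip_apply]
    module

lemma add_smul_v_tail (h : IsF2Pair μ n u v β γ) (hL : IsLeibniz μ) (hn : 4 ≤ n) (t : ℂ)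
    (k : ℕ) : tail μ (u + t • v) (k + 1) = tail μ u (k + 1) := by
  have hd := h.add_smul_v_rightPow hL hn t
  refine le_antisymm (tail_le fun j hj => ?_) ?_
  · obtain ⟨i, rfl⟩ := Nat.exists_eq_add_of_le' hj
    have h1 := tail_anti (show k + 1 ≤ i + k + 2 by omega) (hd (i + k))
    have h2 := rightPow_mem_tail (μ := μ) (u := u) (show k + 1 ≤ i + k + 1 by omega)
    simpa [add_assoc] using Submodule.add_mem _ h1 h2
  -- Downward induction on `k`, starting where the tail of `u` is zero.
  · have key : ∀ m k, n ≤ k + 2 + m → tail μ u (k + 1) ≤ tail μ (u + t • v) (k + 1) := by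
      intro m
      induction m with
      | zero =>
        intro k hk x hx
        rw [h.eq_zero_of_mem_tail (by omega) hx]
        exact Submodule.zero_mem _
      | succ m ih =>
        intro k hk
        have h1 : tail μ u (k + 2) ≤ tail μ (u + t • v) (k + 1) :=
          (ih (k + 1) (by omega)).trans (tail_anti (by omega))
        refine tail_le fun j hj => ?_
        rcases hj.eq_or_lt with rfl | hj
        · have h2 := Submodule.sub_mem _ (rightPow_mem_tail (μ := μ) (u := u + t • v)
            (le_refl (k + 1))) (h1 (hd k))
          simpa using h2
        · exact h1 (rightPow_mem_tail hj)
    exact key n k (by omega)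

/-- Replacing the first generator `u` by `u + t • v`. -/
lemma exists_add_smul_v (h : IsF2Pair μ n u v β γ) (hL : IsLeibniz μ) (hn : 4 ≤ n) (t : ℂ) :
    ∃ (v' : L) (β' : ℕ → ℂ), IsF2Pair μ n (u + t • v) v' β' γ := by
  have hd := h.add_smul_v_rightPow hL hn t
  have ht := h.add_smul_v_tail hL hn t
  have hw3 : rightPow μ u (n - 3) ∈ tail μ u 1 := rightPow_mem_tail (by omega)
  have hw2 : rightPow μ u (n - 2) ∈ tail μ u 2 := rightPow_mem_tail (by omega)
  have hB : μ (rightPow μ u (n - 3)) v = 0 :=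
    h.eq_zero_of_mem_tail (by omega) (h.flip_v_mem_tail hL (rightPow_mem_tail (le_refl (n - 3))))
  have hX : μ (rightPow μ u (n - 3)) u = rightPow μ u (n - 2) := by
    rw [← rightPow_succ, show n - 3 + 1 = n - 2 by omega]
  have htop : rightPow μ (u + t • v) (n - 2) = rightPow μ u (n - 2) := by
    have h1 := h.eq_zero_of_mem_tail (by omega) (hd (n - 3))
    rw [show n - 3 + 1 = n - 2 by omega] at h1
    exact sub_eq_zero.1 h1
  have hvan : rightPow μ (u + t • v) (n - 1) = 0 := by
    have h1 := rightPow_mem_tail (μ := μ) (u := u + t • v) (show n - 2 + 1 ≤ n - 1 by omega)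
    rw [ht] at h1
    exact h.eq_zero_of_mem_tail (by omega) h1
  have huv : μ (u + t • v) (v - (t * γ) • rightPow μ u (n - 3)) ∈ tail μ (u + t • v) 2 := by
    rw [ht 1, map_sub, map_smul, mul_of_mem_tail hL _ hw3, smul_zero, sub_zero, map_add,
      map_smul, LinearMap.add_apply, LinearMap.smul_apply, h.vv]
    exact Submodule.add_mem _ h.uv_mem (Submodule.smul_mem _ _ (Submodule.smul_mem _ _ hw2))
  obtain ⟨c, hc⟩ := exists_eq_sum_of_mem_tail (by omega) hvan huv
  -- The correction cancels `[v, u + t v] = t γ u^{n-2}`, restoring the relation `[v', u'] = 0`. It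
  -- lies in the tail, so right multiplication by `v'` equals that by `v`.
  refine ⟨v - (t * γ) • rightPow μ u (n - 3), fun k => c (k - 2), ⟨?_, ?_, ?_, hvan, ?_, ?_⟩⟩
  · simp only [map_add, map_sub, map_smul, LinearMap.sub_apply, LinearMap.smul_apply, h.vu, h.vv,
      hB, hX]
    module
  · rw [htop, map_sub, map_smul, mul_of_mem_tail hL _ hw3]
    simp only [map_sub, map_smul, LinearMap.sub_apply, LinearMap.smul_apply, h.vv, hB]
    module
  · simpa using hc
  · rw [htop]
    exact h.ne_zero
  · set v' := v - (t * γ) • rightPow μ u (n - 3) with hv'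
    set S := Submodule.span ℂ ({v'} ∪ Set.range (rightPow μ (u + t • v))) with hS
    have hpow : ∀ k, rightPow μ (u + t • v) k ∈ S := fun k =>
      Submodule.subset_span (Or.inr ⟨k, rfl⟩)
    have htS : tail μ u 1 ≤ S := by
      rw [← ht 0]
      exact tail_le fun j _ => hpow j
    have hvS : v ∈ S := by
      have h1 : v' ∈ S := Submodule.subset_span (Or.inl rfl)
      have h2 := Submodule.add_mem _ h1 (Submodule.smul_mem _ (t * γ) (htS hw3))
      simpa [hv'] using h2
    rw [eq_top_iff, ← h.span_eq, Submodule.span_le]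
    rintro x (rfl | ⟨k, rfl⟩)
    · exact hvS
    · cases k with
      | zero =>
        have h1 := Submodule.sub_mem _ (hpow 0) (Submodule.smul_mem _ t hvS)
        simpa using h1
      | succ k => exact htS (rightPow_mem_tail (by omega))

lemma exists_coeff_eq_zero (h : IsF2Pair μ n u v β γ) {a c : ℕ → ℂ} {z : ℕ → L}
    (hz : ∀ i, z i - c i • rightPow μ u (i + 2) ∈ tail μ u (i + 3))
    (hsum : ∑ i ∈ Finset.Icc 2 (n - 2), a i • z i = 0)
    (hex : ∃ i, 2 ≤ i ∧ i + 4 ≤ n ∧ a i ≠ 0) :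
    ∃ m, 2 ≤ m ∧ m + 4 ≤ n ∧ a m ≠ 0 ∧ c m = 0 := by
  classical
  obtain ⟨h2, hn, ha⟩ := Nat.find_spec hex
  refine ⟨Nat.find hex, h2, hn, ha, ?_⟩
  refine (mul_eq_zero.1 (h.leading_coeff_eq_zero hz hsum h2 hn fun i hi hlt => ?_)).resolve_left ha
  by_contra hne
  exact Nat.find_min hex hlt ⟨hi, by omega, hne⟩

/-- For a non-nilpotent pre-derivation with `P u ≡ p u + p' v` and `P v ≡ q' v`, where the even
part of `[u, v]` does not vanish, `q'` is a nonzero multiple of `p`. -/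
lemma exists_eigenvalue (h : IsF2Pair μ n u v β γ) (hL : IsLeibniz μ) (hn : 5 ≤ n) (hev : Even n)
    (hP : IsPreDerivation μ P) (hPu : P u - p • u - p' • v ∈ tail μ u 1)
    (hPv : P v - q' • v ∈ tail μ u 1) (hnil : ¬ ∃ m : ℕ, ∀ x : L, (P ^ m) x = 0)
    (hex : ∃ i, 2 ≤ i ∧ i + 4 ≤ n ∧ Even i ∧ β (i + 2) ≠ 0) :
    p ≠ 0 ∧ ∃ d : ℕ, 2 ≤ d ∧ q' = d * p := by
  obtain ⟨r, r', hr⟩ := h.exists_preDerivation_mul_self hL (by omega) hev hP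
  have hC : ∀ i, (p • μ.flip u + p' • μ.flip v) (rightPow μ u (i + 1)) -
      p • rightPow μ u (i + 2) ∈ tail μ u (i + 3) := fun i => by
    have := h.comb_mem_tail hL p p' (rightPow_mem_tail (μ := μ) (u := u) (le_refl (i + 1)))
    rwa [flip_rightPow] at this
  have hrp : r = 2 * p := by
    have hz : ∀ i, (((μ.flip u) ^ (i + 2)) (P u) - ((μ.flip u) ^ (i + 1)) (P (rightPow μ u 1)) +
        (p • μ.flip u + p' • μ.flip v) (rightPow μ u (i + 1))) -
        (2 * p - r) • rightPow μ u (i + 2) ∈ tail μ u (i + 3) := fun i => by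
      have h1 := flip_pow_mem_tail (i + 2) hPu
      have h2 := flip_pow_mem_tail (i + 1) hr
      simp only [map_sub, map_smul, h.flip_pow_succ_v i, h.flip_pow_succ_v (i + 1),
        flip_pow_rightPow, smul_zero, sub_zero] at h1 h2
      rw [show 1 + (i + 2) = i + 3 by ring,
        show ((μ.flip u) ^ (i + 2)) u = rightPow μ u (i + 2) from rfl] at h1
      rw [show 2 + (i + 1) = i + 3 by ring, show 1 + (i + 1) = i + 2 by ring] at h2
      convert Submodule.add_mem _ (Submodule.sub_mem _ h1 h2) (hC i) using 1
      module
    obtain ⟨i, h2, hi, hie, hne⟩ := hex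
    -- The leading coefficient `2p - r` is the same for every `i`, so one nonzero even-indexed `β`
    -- suffices.
    obtain ⟨m, -, -, -, hm⟩ := h.exists_coeff_eq_zero hz
      (h.sum_preDerivation_even hL (by omega) hP hPu hPv)
      ⟨i, h2, hi, mul_ne_zero hne (by rw [hie.neg_one_pow]; norm_num)⟩
    linear_combination -hm
  have hq : ∃ d : ℕ, 2 ≤ d ∧ q' = d * p := by
    have hz : ∀ i : ℕ, ((i : ℂ) • (p • μ.flip u + p' • μ.flip v) (rightPow μ u (i + 1)) -
        q' • rightPow μ u (i + 2)) - (i * p - q') • rightPow μ u (i + 2) ∈ tail μ u (i + 3) :=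
      fun i => by
        convert Submodule.smul_mem _ (i : ℂ) (hC i) using 1
        module
    obtain ⟨i, h2, hi, -, hne⟩ := hex
    obtain ⟨m, hm2, -, -, hm⟩ := h.exists_coeff_eq_zero hz
      (h.sum_preDerivation_degree hL (by omega) hP hPu hPv) ⟨i, h2, hi, hne⟩
    exact ⟨m, hm2, by linear_combination -hm⟩
  refine ⟨fun hp => hnil ?_, hq⟩
  obtain ⟨d, -, rfl⟩ := hq
  subst hrp hp
  exact h.preDerivation_nilpotent hL hn hP (by simpa using hPu) (by simpa using hPv)
    (by simpa using hr)

/-- If `P u ≡ p u` with `p ≠ 0`, at most one coefficient `β_k` with `k ≤ n - 2` is nonzero. -/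
lemma coeff_unique (h : IsF2Pair μ n u v β γ) (hL : IsLeibniz μ) (hn : 4 ≤ n)
    (hP : IsPreDerivation μ P) (hp : p ≠ 0) (hPu : P u - p • u ∈ tail μ u 1) {i j : ℕ}
    (hi : 4 ≤ i) (hin : i + 2 ≤ n) (hj : 4 ≤ j) (hjn : j + 2 ≤ n) (hβi : β i ≠ 0)
    (hβj : β j ≠ 0) : i = j := by
  obtain ⟨q', hPv⟩ := h.exists_preDerivation_v hL hn hP
  have hsum := h.sum_preDerivation_degree hL (by omega) hP (p := p) (p' := 0) (by simpa using hPu)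
    hPv
  have hsum' : ∑ i ∈ Finset.Icc 2 (n - 2), (β (i + 2) * (i * p - q')) • rightPow μ u (i + 2) = 0 := by
    rw [← hsum]
    refine Finset.sum_congr rfl fun i _ => ?_
    rw [zero_smul, add_zero, LinearMap.smul_apply, flip_rightPow]
    module
  have key : ∀ k, 4 ≤ k → k + 2 ≤ n → β k ≠ 0 → (k - 2 : ℂ) * p = q' := by
    intro k hk hkn hβ
    by_contra hne
    obtain ⟨k, rfl⟩ := Nat.exists_eq_add_of_le' (show 2 ≤ k by omega)
    push_cast at hne
    obtain ⟨m, -, -, -, hm⟩ := h.exists_coeff_eq_zero (c := fun _ => 1)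
      (z := fun i => rightPow μ u (i + 2)) (by simp) hsum'
      ⟨k, by omega, by omega, mul_ne_zero hβ fun h0 => hne (by linear_combination h0)⟩
    exact one_ne_zero hm
  have h1 := mul_right_cancel₀ hp ((key i hi hin hβi).trans (key j hj hjn hβj).symm)
  exact_mod_cast sub_left_injective h1

/-- A non-nilpotent pre-derivation yields generators in normal form. -/
lemma exists_normal_form (h : IsF2Pair μ n u v β γ) (hL : IsLeibniz μ) (hn : 5 ≤ n)
    (hev : Even n) (hns : ¬ IsStronglyNilpotent μ) :
    ∃ (u v : L) (β : ℕ → ℂ) (γ : ℂ), IsF2Pair μ n u v β γ ∧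
      ((∃ s, 2 ≤ s ∧ 2 * s ≤ n - 2 ∧ β (2 * s) = 1 ∧
        ∀ k, 4 ≤ k → k ≤ n - 2 → k ≠ 2 * s → β k = 0) ∨
      ∀ k, 4 ≤ k → k ≤ n - 2 → Even k → β k = 0) := by
  by_cases hex : ∀ k, 4 ≤ k → k ≤ n - 2 → Even k → β k = 0
  · exact ⟨u, v, β, γ, h, Or.inr hex⟩
  push Not at hex
  obtain ⟨k, hk4, hkn, hke, hk⟩ := hex
  rw [IsStronglyNilpotent] at hns
  push Not at hns
  obtain ⟨P, hP, hnil⟩ := hns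
  obtain ⟨p, p', hPu⟩ := h.exists_decomp (P u)
  obtain ⟨q', hPv⟩ := h.exists_preDerivation_v hL (by omega) hP
  obtain ⟨hp, d, hd, hq⟩ := h.exists_eigenvalue hL hn hev hP hPu hPv (by push Not; exact hnil)
    ⟨k - 2, by omega, by omega, (Nat.even_sub (by omega)).2 (by simp [hke]),
      by rwa [Nat.sub_add_cancel (by omega)]⟩
  have hpq : p - q' ≠ 0 := by
    rw [hq, show p - d * p = (1 - d) * p by ring]
    refine mul_ne_zero (sub_ne_zero.2 fun h1 => ?_) hp
    have : d = 1 := by exact_mod_cast h1.symm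
    omega
  -- The parameter solves `p' + t q' = t p`, making `u + t v` an eigenvector of P modulo the tail.
  obtain ⟨v', β', h'⟩ := h.exists_add_smul_v hL (by omega) (p' / (p - q'))
  have hPu' : P (u + (p' / (p - q')) • v) - p • (u + (p' / (p - q')) • v) ∈
      tail μ (u + (p' / (p - q')) • v) 1 := by
    rw [h.add_smul_v_tail hL (by omega) _ 0]
    convert Submodule.add_mem _ hPu (Submodule.smul_mem _ (p' / (p - q')) hPv) using 1
    have ht : p' / (p - q') * (p - q') = p' := div_mul_cancel₀ _ hpq
    rw [map_add, map_smul]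
    linear_combination (norm := module) -(ht • v)
  have huniq : ∀ {i j}, 4 ≤ i → i + 2 ≤ n → 4 ≤ j → j + 2 ≤ n → β' i ≠ 0 → β' j ≠ 0 → i = j :=
    h'.coeff_unique hL (by omega) hP hp hPu'
  by_cases hex' : ∀ k, 4 ≤ k → k ≤ n - 2 → Even k → β' k = 0
  · exact ⟨_, v', β', γ, h', Or.inr hex'⟩
  push Not at hex'
  obtain ⟨m, hm4, hmn, hme, hm⟩ := hex'
  obtain ⟨s, rfl⟩ := even_iff_two_dvd.1 hme
  refine ⟨_, _, _, _, h'.smul_v (inv_ne_zero hm), Or.inl ⟨s, by omega, hmn, inv_mul_cancel₀ hm,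
    fun k hk hkn hne => ?_⟩⟩
  by_contra h0
  exact hne (huniq hk (by omega) hm4 (by omega) (right_ne_zero_of_mul h0) hm)

end IsF2Pair

end NormalForm

end LeibnizPaper

namespace LeibnizPaper

/-! ### Passage between isomorphisms with `F2` and pairs of generators. -/

section Recognition

variable {L : Type*} [AddCommGroup L] [Module ℂ L]
variable {μ : L →ₗ[ℂ] L →ₗ[ℂ] L} {n : ℕ} {u v : L} {β : ℕ → ℂ} {γ : ℂ}

lemma e_eq_zero {k : ℕ} (hk : n < k) : e n k = 0 := by
  ext t
  have := t.2
  simp only [e, Pi.zero_apply, ite_eq_right_iff]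
  omega

lemma e_succ (k : Fin n) : e n (k + 1) = Pi.single k 1 := by
  ext t
  simp [e, Pi.single_apply, Fin.ext_iff]

lemma F2_single (i j : Fin n) :
    F2 n β γ (Pi.single i 1) (Pi.single j 1) = F2table n β γ (i + 1) (j + 1) := by
  simp [F2, LinearMap.mk₂_apply, Pi.single_apply]

lemma F2_e {i j : ℕ} (hi : 1 ≤ i) (hin : i ≤ n) (hj : 1 ≤ j) (hjn : j ≤ n) :
    F2 n β γ (e n i) (e n j) = F2table n β γ i j := by
  obtain ⟨i, rfl⟩ := Nat.exists_eq_add_of_le' hi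
  obtain ⟨j, rfl⟩ := Nat.exists_eq_add_of_le' hj
  exact (congrArg₂ (fun x y => F2 n β γ x y) (e_succ ⟨i, hin⟩) (e_succ ⟨j, hjn⟩)).trans
    (F2_single ⟨i, hin⟩ ⟨j, hjn⟩)

lemma sum_Icc_shift {M : Type*} [AddCommMonoid M] (g : ℕ → M) (n k : ℕ) :
    ∑ t ∈ Finset.Icc (k + 2) n, g t = ∑ i ∈ Finset.Icc 2 (n - k), g (k + i) := by
  refine Finset.sum_bij' (fun t _ => t - k) (fun i _ => k + i) ?_ ?_ ?_ ?_ ?_ <;>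
    simp only [Finset.mem_Icc] <;> intros <;> first | omega | (congr 1; omega)

/-- The images of `e₁`, `e₂` satisfy the defining relations of `F_2(β, γ)`. -/
lemma exists_isF2Pair_of_isomorphic (hn : 4 ≤ n) (h : Isomorphic μ (F2 n β γ)) :
    ∃ u v : L, IsF2Pair μ n u v β γ := by
  obtain ⟨f, hf⟩ := h
  have hpow : ∀ k, f (rightPow μ (f.symm (e n 1)) (k + 1)) = e n (k + 3) := by
    intro k
    induction k with
    | zero =>
      rw [rightPow_succ, hf, rightPow_zero, f.apply_symm_apply,
        F2_e le_rfl (by omega) le_rfl (by omega)]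
      simp [F2table]
    | succ k ih =>
      rw [rightPow_succ, hf, f.apply_symm_apply, ih]
      by_cases hk : k + 3 ≤ n
      · rw [F2_e (by omega) hk le_rfl (by omega), F2table, if_neg (by omega)]
        split_ifs with h1 <;> first | rfl | omega | exact (e_eq_zero (by omega)).symm
      · rw [e_eq_zero (k := k + 3) (by omega), e_eq_zero (k := k + 1 + 3) (by omega), map_zero,
          LinearMap.zero_apply]
  have hpow' : ∀ k, 1 ≤ k → f (rightPow μ (f.symm (e n 1)) k) = e n (k + 2) := by
    intro k hk
    obtain ⟨k, rfl⟩ := Nat.exists_eq_add_of_le' hk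
    exact hpow k
  refine ⟨f.symm (e n 1), f.symm (e n 2), ⟨?_, ?_, ?_, ?_, ?_, ?_⟩⟩
  · apply f.injective
    rw [hf, f.apply_symm_apply, f.apply_symm_apply, F2_e (by omega) (by omega) le_rfl (by omega)]
    simp [F2table]
  · apply f.injective
    rw [hf, f.apply_symm_apply, F2_e (by omega) (by omega) (by omega) (by omega), map_smul,
      hpow' _ (by omega), Nat.sub_add_cancel (by omega)]
    simp [F2table]
  · apply f.injective
    rw [hf, f.apply_symm_apply, f.apply_symm_apply,
      F2_e (by omega) (by omega) (by omega) (by omega), map_sum]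
    rw [F2table, if_neg (by omega), if_neg (by omega), if_pos ⟨rfl, rfl⟩, sum_Icc_shift _ n 2]
    refine Finset.sum_congr rfl fun i hi => ?_
    rw [map_smul, hpow' _ (by have := (Finset.mem_Icc.1 hi).1; omega), add_comm 2 i]
  · apply f.injective
    rw [hpow' _ (by omega), e_eq_zero (by omega), map_zero]
  · intro h0
    have h1 := hpow' (n - 2) (by omega)
    rw [h0, map_zero, Nat.sub_add_cancel (by omega)] at h1
    have h2 := congrFun h1 ⟨n - 1, by omega⟩
    simp [e, Nat.sub_add_cancel (show 1 ≤ n by omega)] at h2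
  · rw [eq_top_iff]
    rintro x -
    have hx : x = ∑ k : Fin n, f x k • f.symm (e n (k + 1)) := by
      apply f.injective
      simp only [map_sum, map_smul, f.apply_symm_apply, e_succ]
      exact pi_eq_sum_univ' (f x)
    rw [hx]
    refine Submodule.sum_mem _ fun k _ => Submodule.smul_mem _ _ (Submodule.subset_span ?_)
    obtain ⟨k, hk⟩ := k
    match k with
    | 0 => exact Or.inr ⟨0, rfl⟩
    | 1 => exact Or.inl rfl
    | k + 2 =>
      refine Or.inr ⟨k + 1, f.injective ?_⟩
      rw [hpow, f.apply_symm_apply]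

/-- Generators with the defining relations of `F_2(β, γ)` give an isomorphism with it. -/
lemma IsF2Pair.isomorphic (h : IsF2Pair μ n u v β γ) (hL : IsLeibniz μ) (hn : 4 ≤ n)
    (hdim : Module.finrank ℂ L = n) : Isomorphic μ (F2 n β γ) := by
  -- Truncated subtraction gives `E 1 = u`; slot 2 is reserved for `v`, and `E k` is `u^{k-2}` from
  -- 3 on.
  set E : ℕ → L := fun k => if k = 2 then v else rightPow μ u (k - 2) with hE
  have hE2 : E 2 = v := if_pos rfl
  have hEne : ∀ k, k ≠ 2 → E k = rightPow μ u (k - 2) := fun k hk => if_neg hk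
  have hspan : ⊤ ≤ Submodule.span ℂ (Set.range fun k : Fin n => E (k + 1)) := by
    rw [← h.span_eq, Submodule.span_le]
    rintro x (rfl | ⟨k, rfl⟩)
    · exact Submodule.subset_span ⟨⟨1, by omega⟩, hE2⟩
    · by_cases hk : n - 1 ≤ k
      · rw [h.rightPow_eq_zero hk]
        exact Submodule.zero_mem _
      · cases k with
        | zero => exact Submodule.subset_span ⟨⟨0, by omega⟩, hEne 1 (by omega)⟩
        | succ k => exact Submodule.subset_span ⟨⟨k + 2, by omega⟩, hEne (k + 3) (by omega)⟩
  set b := basisOfTopLeSpanOfCardEqFinrank (fun k : Fin n => E (k + 1)) hspan (by simp [hdim])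
    with hb
  set g := b.equivFun.symm with hg
  have hgs : ∀ k : Fin n, g (Pi.single k 1) = E (k + 1) := fun k => by
    rw [hg, Module.Basis.equivFun_symm_apply]
    simp [hb, Pi.single_apply]
  have hge : ∀ k, 1 ≤ k → g (e n k) = E k := by
    intro k hk
    by_cases hkn : k ≤ n
    · obtain ⟨k, rfl⟩ := Nat.exists_eq_add_of_le' hk
      exact (congrArg g (e_succ ⟨k, hkn⟩)).trans (hgs ⟨k, hkn⟩)
    · rw [e_eq_zero (by omega), map_zero, hEne k (by omega), h.rightPow_eq_zero (by omega)]
  have hmul : ∀ i j, 1 ≤ i → i ≤ n → 1 ≤ j → j ≤ n →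
      μ (E i) (E j) = g (F2table n β γ i j) := by
    intro i j hi hin hj hjn
    rcases (show j = 1 ∨ j = 2 ∨ 3 ≤ j by omega) with rfl | rfl | hj3
    · have hE1 : E 1 = u := hEne 1 (by omega)
      rw [hE1]
      rcases (show i = 1 ∨ i = 2 ∨ (3 ≤ i ∧ i ≤ n - 1) ∨ i = n by omega) with rfl | rfl | hi3 | rfl
      · simp only [F2table, and_self, if_true]
        rw [hge 3 (by omega), hEne 3 (by omega), hE1, rightPow_succ, rightPow_zero]
      · simp [F2table, hE2, h.vu]
      · rw [F2table, if_neg (by omega), if_pos (by omega), hge _ (by omega), hEne _ (by omega),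
          hEne _ (by omega), ← rightPow_succ, show i - 2 + 1 = i + 1 - 2 by omega]
      · rw [F2table, if_neg (by omega), if_neg (by omega), if_neg (by omega), if_neg (by omega),
          if_neg (by omega), map_zero, hEne _ (by omega), ← rightPow_succ,
          h.rightPow_eq_zero (by omega)]
    · rw [hE2]
      rcases (show i = 1 ∨ i = 2 ∨ (3 ≤ i ∧ i ≤ n - 2) ∨ (3 ≤ i ∧ n - 1 ≤ i) by omega) with
        rfl | rfl | hi3 | hi3
      · rw [F2table, if_neg (by omega), if_neg (by omega), if_pos (by omega), hEne _ (by omega),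
          sum_Icc_shift _ n 2, map_sum]
        refine h.uv.trans (Finset.sum_congr rfl fun i hi => ?_)
        have := (Finset.mem_Icc.1 hi).1
        rw [map_smul, hge _ (by omega), hEne _ (by omega), add_comm 2 i, Nat.add_sub_cancel]
      · rw [F2table, if_neg (by omega), if_neg (by omega), if_neg (by omega), if_pos (by omega),
          hE2, map_smul, hge _ (by omega), hEne _ (by omega), h.vv]
      · rw [F2table, if_neg (by omega), if_neg (by omega), if_neg (by omega), if_neg (by omega),
          if_pos (by omega), hEne _ (by omega), h.mul_v hL, sum_Icc_shift _ n i, map_sum]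
        -- The table stops at `s = n - i` while `mul_v` runs to `n - 2`; the surplus powers vanish.
        refine (Finset.sum_subset (Finset.Icc_subset_Icc_right (by omega)) fun s hs hs' => ?_).symm.trans
          (Finset.sum_congr rfl fun s hs => ?_)
        · simp only [Finset.mem_Icc] at hs hs'
          rw [h.rightPow_eq_zero (by omega), smul_zero]
        · have := (Finset.mem_Icc.1 hs).1
          rw [map_smul, hge _ (by omega), hEne _ (by omega), Nat.add_sub_cancel_left,
            show i + s - 2 = i - 2 + s by omega]
      · rw [F2table, if_neg (by omega), if_neg (by omega), if_neg (by omega), if_neg (by omega),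
          if_neg (by omega), map_zero, hEne _ (by omega), h.mul_v hL]
        refine Finset.sum_eq_zero fun s hs => ?_
        have := (Finset.mem_Icc.1 hs).1
        rw [h.rightPow_eq_zero (by omega), smul_zero]
    · rw [F2table, if_neg (by omega), if_neg (by omega), if_neg (by omega), if_neg (by omega),
        if_neg (by omega), map_zero, hEne j (by omega), show j - 2 = j - 3 + 1 by omega,
        mul_rightPow hL]
  have hbil : μ.compl₁₂ g.toLinearMap g.toLinearMap = (F2 n β γ).compr₂ g.toLinearMap := by
    refine LinearMap.ext_basis (Pi.basisFun ℂ (Fin n)) (Pi.basisFun ℂ (Fin n)) fun i j => ?_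
    simp only [LinearMap.compl₁₂_apply, LinearMap.compr₂_apply, Pi.basisFun_apply,
      LinearEquiv.coe_coe, F2_single, hgs]
    exact hmul _ _ (by omega) (by omega) (by omega) (by omega)
  refine ⟨g.symm, fun x y => ?_⟩
  have := LinearMap.congr_fun₂ hbil (g.symm x) (g.symm y)
  simp only [LinearMap.compl₁₂_apply, LinearMap.compr₂_apply, LinearEquiv.coe_coe,
    LinearEquiv.apply_symm_apply] at this
  rw [this, LinearEquiv.symm_apply_apply]

end Recognition

end LeibnizPaper

theorem theorem4p5 {L : Type*} [AddCommGroup L] [Module ℂ L] [FiniteDimensional ℂ L]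
    (μ : L →ₗ[ℂ] L →ₗ[ℂ] L) (n : ℕ) (hn : Even n) (hn4 : 4 ≤ n)
    (hdim : Module.finrank ℂ L = n)
    (hLeibniz : LeibnizPaper.IsLeibniz μ) (hfil : LeibnizPaper.IsFiliform μ)
    (hF2 : ∃ (β : ℕ → ℂ) (γ : ℂ), LeibnizPaper.Isomorphic μ (LeibnizPaper.F2 n β γ))
    (hns : ¬ LeibnizPaper.IsStronglyNilpotent μ) :
    (∃ (s : ℕ) (β : ℕ → ℂ) (γ : ℂ), 2 ≤ s ∧ 2 * s ≤ n - 2 ∧ β (2 * s) = 1 ∧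
        (∀ k, 4 ≤ k → k ≤ n - 2 → k ≠ 2 * s → β k = 0) ∧
        LeibnizPaper.Isomorphic μ (LeibnizPaper.F2 n β γ)) ∨
    (∃ (β : ℕ → ℂ) (γ : ℂ), (∀ k, 4 ≤ k → k ≤ n - 2 → Even k → β k = 0) ∧
        LeibnizPaper.Isomorphic μ (LeibnizPaper.F2 n β γ)) := by
  obtain ⟨β, γ, hiso⟩ := hF2
  -- For `n = 4` the range `4 ≤ k ≤ n - 2` is empty, so the second form holds for any parameters.
  rcases hn4.eq_or_lt with rfl | hn5
  · exact Or.inr ⟨β, γ, fun k hk hk' _ => by omega, hiso⟩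
  obtain ⟨u, v, h⟩ := LeibnizPaper.exists_isF2Pair_of_isomorphic hn4 hiso
  obtain ⟨u, v, β, γ, h, ⟨s, hs, hsn, h1, h0⟩ | h0⟩ := h.exists_normal_form hLeibniz hn5 hn hns
  · exact Or.inl ⟨s, β, γ, hs, hsn, h1, h0, h.isomorphic hLeibniz hn4 hdim⟩
  · exact Or.inr ⟨β, γ, h0, h.isomorphic hLeibniz hn4 hdim⟩
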